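/- Let $D\subseteq\mathbb{R}^n$ be open with $0\in D$, let $F\in C^2(D;\mathbb{R}^n)$ with $F(0)=0$, and suppose that $\dot x=F(x)$ induces a flow $S^t:D\to D$, $t\in\mathbb{R}$. Put $A=DF(0)$ and assume that every eigenvalue of $A$ has non-zero real part. Let $h:\mathcal N\to\mathcal V$ be a local linearization at $0$: a homeomorphism (for instance a $C^1$ diffeomorphism) of an open neighbourhood $\mathcal N\subseteq D$ of $0$ onto an open set $\mathcal V\subseteq\mathbb{R}^n$ such that for each $x\in\mathcal N$ there is an open interval $I(x)\ni 0$ with $S^t x\in\mathcal N$ and $h(S^t x)=e^{tA}h(x)$ for all $t\in I(x)$. Let $V$ be an invertible complex matrix such that $J=V^{-1}AV$ is in Jordan normal form, with diagonal entries $\lambda_1,\dots,\lambda_n$, and let $k=V^{-1}h$. Call an open connected set $N\ni 0$ admissible if $\overline N\subset\mathcal N$ and, for every $y\in h(\overline N)$, the set of times $\{t\in\mathbb{R}: e^{tA}y\in h(\overline N)\}$ is an interval. Given such an $N$, let $P$ be the set of $z\in D$ with $S^tz\in\overline N$ for some $t\in\mathbb{R}$. For $z\in P$ let $t(z)$ be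 the least $t\ge 0$ with $S^tz\in\overline N$ if there is such a $t\ge0$, and otherwise the greatest $t<0$ with $S^tz\in\overline N$. Let $s=(s_1,\dots,s_n):P\to\mathbb{C}^n$ be the extension of $k$ along the flow, $$s(z)=e^{-t(z)J}\,k(S^{t(z)}z)\qquad(z\in P)$$ (so $s_i(z)=e^{-\lambda_i t(z)}k_i(S^{t(z)}z)$ when $J$ is diagonal), or, alternatively, let $s=(s_1,\dots,s_n)$ be any family of (generalized) open eigenfunctions of the Koopman operator on $P$ with $s=k$ on $\overline N$; that is, $s(S^\tau x)=e^{\tau J}s(x)$ for $x\in P$ and all $\tau$ in any open interval containing $0$ on which the trajectory of $x$ stays in $P$. Let $W^s_P$ be the principal part of the stable manifold: the set of $z\in P$ with $S^tz\to0$ as $t\to+\infty$ for which $x=S^{t(z)}z$ lies in the local stable manifold, i.e. $S^tx\in\overline N$ for all $t\ge0$ and $S^tx\to0$ as $t\to+\infty$. Let $W^u_P$ be defined in the same way with $t\le 0$ and $t\to-\infty$. Then every neighbourhood of $0$ contains an admissible $N$, and for every admissible $N$ and every such $s$ $$\{x\in P: s_i(x)=0\text{ for all } i \text{ with } \operatorname{Re}\lambda_i>0\}=W^s_P,\qquad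 \{x\in P: s_i(x)=0\text{ for all } i \text{ with } \operatorname{Re}\lambda_i<0\}=W^u_P .$$ -/

import Mathlib

open Filter Topology

noncomputable section

namespace Koopman

/-- The Euclidean state space `ℝⁿ`. -/
abbrev E (n : ℕ) : Type := EuclideanSpace ℝ (Fin n)

/-- `S : D × ℝ → D` is the flow on `D` of the autonomous system `x' = F x`: for `x ∈ D` the curve
`t ↦ S t x` is the solution through `x`, it is defined for all times and stays in `D`. -/
def IsFlowOn {n : ℕ} (F : E n → E n) (D : Set (E n)) (S : ℝ → E n → E n) : Prop :=
  ∀ x ∈ D, S 0 x = x ∧ ∀ t : ℝ, S t x ∈ D ∧ HasDerivAt (fun τ => S τ x) (F (S t x)) t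

/-- The matrix of `DF` at the origin, with complex entries. -/
def jacobian {n : ℕ} (F : E n → E n) : Matrix (Fin n) (Fin n) ℂ :=
  Matrix.of fun i j => ((fderiv ℝ F 0 (EuclideanSpace.single j 1) i : ℝ) : ℂ)

/-- All eigenvalues of `DF` at the origin have non-zero real part. -/
def IsHyperbolic {n : ℕ} (F : E n → E n) : Prop :=
  ∀ μ ∈ spectrum ℂ (jacobian F), μ.re ≠ 0

/-- Complex Jordan normal form: the only possibly non-zero entries are the diagonal ones
and entries `1` directly above the diagonal, between equal diagonal entries. -/
def IsJordan {n : ℕ} (J : Matrix (Fin n) (Fin n) ℂ) : Prop :=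
  ∀ i j : Fin n, i ≠ j → J i j ≠ 0 → (j : ℕ) = i + 1 ∧ J i j = 1 ∧ J i i = J j j

/-- The linearized flow `e^{tA}`, with `A = DF` at the origin. -/
def linFlow {n : ℕ} (F : E n → E n) (t : ℝ) : E n →L[ℝ] E n :=
  NormedSpace.exp (t • fderiv ℝ F 0)

/-- `h` is a local linearization of the flow at the origin, as in the Hartman-Grobman theorem:
a homeomorphism of an open neighbourhood `h.source ⊆ D` of the origin onto an open set
`h.target`, such that every `x ∈ h.source` has an open interval `I` of times around `0`
on which `h (S t x) = e^{tA} (h x)`. A `C¹` diffeomorphism is a special case. -/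
structure IsLinearization {n : ℕ} (F : E n → E n) (D : Set (E n)) (S : ℝ → E n → E n)
    (h : OpenPartialHomeomorph (E n) (E n)) : Prop where
  zero_mem : (0 : E n) ∈ h.source
  source_subset : h.source ⊆ D
  conj : ∀ x ∈ h.source, ∃ I : Set ℝ, IsOpen I ∧ I.OrdConnected ∧ (0 : ℝ) ∈ I ∧
    ∀ t ∈ I, S t x ∈ h.source ∧ h (S t x) = linFlow F t (h x)

/-- `N` is an open connected neighbourhood of the origin whose closure lies in the domain of
`h` and has an image that every trajectory of the linearized system meets in a (possibly
empty, possibly infinite) interval of times. -/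
structure IsAdmissible {n : ℕ} (F : E n → E n) (h : OpenPartialHomeomorph (E n) (E n))
    (N : Set (E n)) : Prop where
  isOpen : IsOpen N
  isConnected : IsConnected N
  zero_mem : (0 : E n) ∈ N
  closure_subset : closure N ⊆ h.source
  ordConnected : ∀ y ∈ h '' closure N, {t : ℝ | linFlow F t y ∈ h '' closure N}.OrdConnected

/-- The local functions `k = V⁻¹ h`. -/
def localEigen {n : ℕ} (h : OpenPartialHomeomorph (E n) (E n)) (V : Matrix (Fin n) (Fin n) ℂ)
    (x : E n) : Fin n → ℂ :=
  V⁻¹.mulVec fun i => ((h x i : ℝ) : ℂ)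

/-- The set `P` of points of the state space `D` whose trajectory, forward or backward in time,
meets the closure of `N`. -/
def domainP {n : ℕ} (S : ℝ → E n → E n) (D N : Set (E n)) : Set (E n) :=
  {z | z ∈ D ∧ ∃ t : ℝ, S t z ∈ closure N}

open Classical in
/-- The time `t(z)` to enter the closure of `N`: the first time `t ≥ 0` with `S t z ∈ closure N`
if there is one (so `t(z) = 0` for `z ∈ closure N`), and otherwise the last time `t < 0` with
`S t z ∈ closure N`. It is meant for `z` in `domainP S D N`, where these times exist. -/
def entryTime {n : ℕ} (S : ℝ → E n → E n) (N : Set (E n)) (z : E n) : ℝ :=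
  if ∃ t : ℝ, 0 ≤ t ∧ S t z ∈ closure N then sInf {t : ℝ | 0 ≤ t ∧ S t z ∈ closure N}
  else sSup {t : ℝ | t ≤ 0 ∧ S t z ∈ closure N}

/-- On `P`, `s` is the extension of `k` along the flow,
`s z = e^{-t(z) J} k (S^{t(z)} z)`. For diagonal `J` this is
`s_i z = e^{-λ_i t(z)} k_i (S^{t(z)} z)`. -/
def IsFlowExtension {n : ℕ} (S : ℝ → E n → E n) (D N : Set (E n))
    (J : Matrix (Fin n) (Fin n) ℂ) (k s : E n → Fin n → ℂ) : Prop :=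
  ∀ z ∈ domainP S D N,
    s z = (NormedSpace.exp (((-entryTime S N z : ℝ) : ℂ) • J)).mulVec (k (S (entryTime S N z) z))

/-- The components of `s` are (generalized) open eigenfunctions of the Koopman family on `P`,
associated with the diagonal entries (eigenvalues) of the Jordan matrix `J`: along every piece of
trajectory that stays in `P` one has `s ∘ S^τ = e^{τ J} s`, which is the solution of `s' = J s`.
For diagonal `J` this is `s_i (S^τ x) = e^{λ_i τ} s_i x`. -/
def IsOpenEigenfamily {n : ℕ} (S : ℝ → E n → E n) (P : Set (E n))
    (J : Matrix (Fin n) (Fin n) ℂ) (s : E n → Fin n → ℂ) : Prop :=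
  ∀ x ∈ P, ∀ I : Set ℝ, IsOpen I → I.OrdConnected → (0 : ℝ) ∈ I → (∀ τ ∈ I, S τ x ∈ P) →
    ∀ τ ∈ I, s (S τ x) = (NormedSpace.exp ((τ : ℂ) • J)).mulVec (s x)

/-- The stable manifold of the origin. -/
def stableManifold {n : ℕ} (S : ℝ → E n → E n) (D : Set (E n)) : Set (E n) :=
  {z | z ∈ D ∧ Tendsto (fun t => S t z) atTop (𝓝 0)}

/-- The unstable manifold of the origin. -/
def unstableManifold {n : ℕ} (S : ℝ → E n → E n) (D : Set (E n)) : Set (E n) :=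
  {z | z ∈ D ∧ Tendsto (fun t => S t z) atBot (𝓝 0)}

/-- The local stable manifold of the origin in `K`. -/
def localStable {n : ℕ} (S : ℝ → E n → E n) (K : Set (E n)) : Set (E n) :=
  {x | (∀ t : ℝ, 0 ≤ t → S t x ∈ K) ∧ Tendsto (fun t => S t x) atTop (𝓝 0)}

/-- The local unstable manifold of the origin in `K`. -/
def localUnstable {n : ℕ} (S : ℝ → E n → E n) (K : Set (E n)) : Set (E n) :=
  {x | (∀ t : ℝ, t ≤ 0 → S t x ∈ K) ∧ Tendsto (fun t => S t x) atBot (𝓝 0)}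

/-- The principal part `W^s_P` of the stable manifold. -/
def principalStable {n : ℕ} (S : ℝ → E n → E n) (D N : Set (E n)) : Set (E n) :=
  {z | z ∈ domainP S D N ∧ z ∈ stableManifold S D ∧
    S (entryTime S N z) z ∈ localStable S (closure N)}

/-- The principal part `W^u_P` of the unstable manifold. -/
def principalUnstable {n : ℕ} (S : ℝ → E n → E n) (D N : Set (E n)) : Set (E n) :=
  {z | z ∈ domainP S D N ∧ z ∈ unstableManifold S D ∧
    S (entryTime S N z) z ∈ localUnstable S (closure N)}

end Koopman

end

/-! The flow carries every `z ∈ P` to its entry point in `closure N`, and `s z` is `k` at that point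
multiplied by some `e^{tJ}`. A Jordan matrix couples only coordinates with equal diagonal entries,
so `e^{tJ}` preserves the vanishing of the coordinates singled out by the sign of `Re λ`. This
reduces the theorem to points `x` of `closure N` (`eigenfamily_eq_zero_iff`), which
`IsAdmissible.localEigen_eq_zero_iff` settles.

There `c t = V⁻¹ e^{tA} h x` solves `c' = J c`. If its unstable coordinates vanish at time 0, they
vanish always, the others decay, and the linear trajectory tends to 0. It lies in `h '' closure N`
at time 0 and at all late times, hence by admissibility at all times between, and `h.symm` carries
this back to the flow. Conversely, a trajectory that stays in `closure N` and tends to 0 gives `c →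
0`, which leaves no unstable coordinate. Reversing time replaces `J` by `-J` and gives the unstable
manifold.

Decay comes from a weighted sum of squares that is a Lyapunov function for nontrivial Jordan blocks
too. Boxes cut out by this energy for `J` and for `-J`, pulled back by `h`, are the admissible
neighbourhoods. -/

namespace Koopman

open Matrix

variable {n : ℕ}

/-- Jordan form up to the size of the entries above the diagonal, which may be any number of modulus
at most one. Unlike `IsJordan` this is invariant under `M ↦ -M`. -/
def IsJordanLike (M : Matrix (Fin n) (Fin n) ℂ) : Prop :=
  ∀ i j : Fin n, i ≠ j → M i j ≠ 0 → (j : ℕ) = i + 1 ∧ ‖M i j‖ ≤ 1 ∧ M i i = M j j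

theorem IsJordan.isJordanLike {J : Matrix (Fin n) (Fin n) ℂ} (hJ : IsJordan J) :
    IsJordanLike J := fun i j hij h0 =>
  have h := hJ i j hij h0
  ⟨h.1, by simp [h.2.1], h.2.2⟩

theorem IsJordanLike.neg {M : Matrix (Fin n) (Fin n) ℂ} (hM : IsJordanLike M) :
    IsJordanLike (-M) := fun i j hij h0 => by
  have h := hM i j hij (by simpa using h0)
  exact ⟨h.1, by simpa using h.2.1, by simp [h.2.2]⟩

/-- The coordinates in which `z' = M z` decays. -/
noncomputable def stableIndices (M : Matrix (Fin n) (Fin n) ℂ) : Finset (Fin n) :=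
  Finset.univ.filter fun i => (M i i).re < 0

theorem mem_stableIndices {M : Matrix (Fin n) (Fin n) ℂ} {i : Fin n} :
    i ∈ stableIndices M ↔ (M i i).re < 0 := by
  simp [stableIndices]

/-- A Lyapunov function for the stable coordinates of `z' = M z`. -/
noncomputable def energy (M : Matrix (Fin n) (Fin n) ℂ) (a : ℝ) (z : Fin n → ℂ) : ℝ :=
  ∑ i ∈ stableIndices M, (2 / a) ^ (2 * (i : ℕ)) * ‖z i‖ ^ 2

/-! ### Lyapunov estimates for linear systems in Jordan form. -/

section Energy

variable {M : Matrix (Fin n) (Fin n) ℂ} {a : ℝ} {z : Fin n → ℂ}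

theorem energy_nonneg (ha : 0 < a) (z : Fin n → ℂ) : 0 ≤ energy M a z :=
  Finset.sum_nonneg fun _ _ => by positivity

theorem norm_sq_le_energy (ha : 0 < a) (ha1 : a ≤ 1) (z : Fin n → ℂ) {i : Fin n}
    (hi : i ∈ stableIndices M) : ‖z i‖ ^ 2 ≤ energy M a z := by
  have h1 : 1 ≤ (2 / a) ^ (2 * (i : ℕ)) :=
    one_le_pow₀ (by rw [le_div_iff₀ ha]; linarith)
  calc ‖z i‖ ^ 2 ≤ (2 / a) ^ (2 * (i : ℕ)) * ‖z i‖ ^ 2 := le_mul_of_one_le_left (by positivity) h1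
    _ ≤ energy M a z :=
      Finset.single_le_sum (f := fun i : Fin n => (2 / a) ^ (2 * (i : ℕ)) * ‖z i‖ ^ 2)
        (fun _ _ => by positivity) hi

theorem energy_smul (r : ℝ) (z : Fin n → ℂ) :
    energy M a (fun i => (r : ℂ) * z i) = r ^ 2 * energy M a z := by
  simp only [energy, Finset.mul_sum, norm_mul, mul_pow, Complex.norm_real, Real.norm_eq_abs, sq_abs]
  exact Finset.sum_congr rfl fun _ _ => by ring

@[fun_prop]
theorem continuous_energy : Continuous (energy M a) := by
  unfold energy; fun_prop

theorem energy_zero : energy M a 0 = 0 := by simp [energy]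

/-- The weighted estimate for a single row of the matrix. -/
theorem IsJordanLike.inner_row_le (hM : IsJordanLike M) (ha : 0 < a)
    (hre : ∀ i, a ≤ |(M i i).re|) (z : Fin n → ℂ) {i : Fin n} (hi : i ∈ stableIndices M) :
    (2 / a) ^ (2 * (i : ℕ)) * inner ℝ (z i) ((M *ᵥ z) i) ≤
      -a * ((2 / a) ^ (2 * (i : ℕ)) * ‖z i‖ ^ 2) +
      ∑ j ∈ stableIndices M, if i ≠ j ∧ M i j ≠ 0 then
        a / 2 * ((2 / a) ^ (2 * (i : ℕ)) * ‖z i‖ ^ 2) +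
        a / 8 * ((2 / a) ^ (2 * (j : ℕ)) * ‖z j‖ ^ 2) else 0 := by
  have hi' := mem_stableIndices.1 hi
  set w : Fin n → ℝ := fun i => (2 / a) ^ (2 * (i : ℕ)) with hw
  have hwpos : ∀ i, 0 < w i := fun i => by positivity
  have hoff : ∀ j ∈ Finset.univ.erase i, w i * inner ℝ (z i) (M i j * z j) ≤
      if i ≠ j ∧ M i j ≠ 0 then
        a / 2 * (w i * ‖z i‖ ^ 2) + a / 8 * (w j * ‖z j‖ ^ 2) else 0 := by
    intro j hj
    have hij : i ≠ j := (Finset.ne_of_mem_erase hj).symm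
    by_cases h0 : M i j = 0
    · simp [h0]
    rw [if_pos ⟨hij, h0⟩]
    obtain ⟨h1, h2, -⟩ := hM i j hij h0
    -- The weights grow by `4 / a ^ 2` per index, which turns the large Young coefficient `1 / (2 *
    -- a)` below into `a / 8`.
    have h3 : w j = 4 / a ^ 2 * w i := by
      simp only [hw, h1]; rw [mul_add, pow_add]; ring
    have h4 : inner ℝ (z i) (M i j * z j) ≤ ‖z i‖ * ‖z j‖ := by
      refine (real_inner_le_norm _ _).trans ?_
      rw [norm_mul]
      gcongr
      exact mul_le_of_le_one_left (norm_nonneg _) h2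
    have h5 : ‖z i‖ * ‖z j‖ ≤ a / 2 * ‖z i‖ ^ 2 + 1 / (2 * a) * ‖z j‖ ^ 2 := by
      have : a / 2 * ‖z i‖ ^ 2 + 1 / (2 * a) * ‖z j‖ ^ 2 - ‖z i‖ * ‖z j‖
          = (a * ‖z i‖ - ‖z j‖) ^ 2 / (2 * a) := by field_simp; ring
      have : 0 ≤ (a * ‖z i‖ - ‖z j‖) ^ 2 / (2 * a) := by positivity
      linarith
    calc w i * inner ℝ (z i) (M i j * z j)
        ≤ w i * (a / 2 * ‖z i‖ ^ 2 + 1 / (2 * a) * ‖z j‖ ^ 2) := by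
          have := (hwpos i).le
          gcongr
          exact h4.trans h5
      _ = _ := by rw [h3]; field_simp; ring
  have hdiag : inner ℝ (z i) (M i i * z i) ≤ -a * ‖z i‖ ^ 2 := by
    have h1 : inner ℝ (z i) (M i i * z i) = (M i i).re * ‖z i‖ ^ 2 := by
      rw [Complex.inner, ← Complex.normSq_eq_norm_sq]
      simp [Complex.normSq_apply]; ring
    have := hre i
    rw [abs_of_neg hi'] at this
    rw [h1]
    gcongr
    linarith
  have hsplit : (M *ᵥ z) i = M i i * z i + ∑ j ∈ Finset.univ.erase i, M i j * z j := by
    rw [Finset.add_sum_erase _ (fun j => M i j * z j) (Finset.mem_univ i)]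
    rfl
  rw [hsplit, inner_add_right, inner_sum, mul_add, Finset.mul_sum]
  refine add_le_add ?_ ((Finset.sum_le_sum hoff).trans ?_)
  · have := mul_le_mul_of_nonneg_left hdiag (hwpos i).le
    linarith
  · rw [Finset.sum_erase _ (by simp)]
    -- A stable row couples only to stable columns, since coupled diagonal entries are equal.
    refine le_of_eq (Finset.sum_subset (Finset.subset_univ _) fun j _ hj => if_neg ?_).symm
    rintro ⟨hij, h0⟩
    exact hj (mem_stableIndices.2 ((hM i j hij h0).2.2 ▸ hi'))

/-- The dissipation estimate for the energy. -/
theorem IsJordanLike.sum_inner_le (hM : IsJordanLike M) (ha : 0 < a)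
    (hre : ∀ i, a ≤ |(M i i).re|) (z : Fin n → ℂ) :
    ∑ i ∈ stableIndices M, (2 / a) ^ (2 * (i : ℕ)) * (2 * inner ℝ (z i) ((M *ᵥ z) i)) ≤
      -(a / 2) * energy M a z := by
  set q : Fin n → ℝ := fun i => (2 / a) ^ (2 * (i : ℕ)) * ‖z i‖ ^ 2 with hq
  have hq0 : ∀ i, 0 ≤ q i := fun i => by positivity
  set I := stableIndices M
  -- Each row, and likewise each column, has at most one non-zero off-diagonal entry.
  have hrow : ∀ i, ∑ j ∈ I, (if i ≠ j ∧ M i j ≠ 0 then a / 2 * q i else 0) ≤ a / 2 * q i := by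
    intro i
    rw [← Finset.sum_filter, Finset.sum_const, nsmul_eq_mul]
    refine mul_le_of_le_one_left (mul_nonneg (by positivity) (hq0 i)) ?_
    norm_cast
    refine Finset.card_le_one.2 fun j hj k hk => ?_
    rw [Finset.mem_filter] at hj hk
    have h1 := (hM i j hj.2.1 hj.2.2).1
    have h2 := (hM i k hk.2.1 hk.2.2).1
    exact Fin.ext (by omega)
  have hcol : ∀ j, ∑ i ∈ I, (if i ≠ j ∧ M i j ≠ 0 then a / 8 * q j else 0) ≤ a / 8 * q j := by
    intro j
    rw [← Finset.sum_filter, Finset.sum_const, nsmul_eq_mul]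
    refine mul_le_of_le_one_left (mul_nonneg (by positivity) (hq0 j)) ?_
    norm_cast
    refine Finset.card_le_one.2 fun i hi k hk => ?_
    rw [Finset.mem_filter] at hi hk
    have h1 := (hM i j hi.2.1 hi.2.2).1
    have h2 := (hM k j hk.2.1 hk.2.2).1
    exact Fin.ext (by omega)
  have hE : energy M a z = ∑ i ∈ I, q i := rfl
  have hmain := Finset.sum_le_sum fun i (hi : i ∈ I) => hM.inner_row_le ha hre z hi
  have hsplit : ∀ i, (∑ j ∈ I, if i ≠ j ∧ M i j ≠ 0 then a / 2 * q i + a / 8 * q j else 0) =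
      (∑ j ∈ I, if i ≠ j ∧ M i j ≠ 0 then a / 2 * q i else 0) +
      ∑ j ∈ I, if i ≠ j ∧ M i j ≠ 0 then a / 8 * q j else 0 := fun i => by
    rw [← Finset.sum_add_distrib]
    exact Finset.sum_congr rfl fun j _ => by split_ifs <;> simp
  change _ ≤ ∑ i ∈ I, (-a * q i +
    ∑ j ∈ I, if i ≠ j ∧ M i j ≠ 0 then a / 2 * q i + a / 8 * q j else 0) at hmain
  simp only [hsplit, Finset.sum_add_distrib] at hmain
  rw [Finset.sum_comm (f := fun i j => if i ≠ j ∧ M i j ≠ 0 then a / 8 * q j else 0)] at hmain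
  have h1 := Finset.sum_le_sum fun i (_ : i ∈ I) => hrow i
  have h2 := Finset.sum_le_sum fun j (_ : j ∈ I) => hcol j
  rw [← Finset.mul_sum] at h1 h2 hmain
  have h3 : ∑ i ∈ I, (2 / a) ^ (2 * (i : ℕ)) * (2 * inner ℝ (z i) ((M *ᵥ z) i)) =
      2 * ∑ i ∈ I, (2 / a) ^ (2 * (i : ℕ)) * inner ℝ (z i) ((M *ᵥ z) i) := by
    rw [Finset.mul_sum]
    exact Finset.sum_congr rfl fun _ _ => by ring
  have h4 : 0 ≤ ∑ i ∈ I, q i := Finset.sum_nonneg fun i _ => hq0 i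
  rw [h3, hE]
  -- The total coefficient is `2 * (-a + a / 2 + a / 8) = -3 * a / 4`, below `-a / 2`.
  nlinarith

theorem hasDerivAt_energy {c : ℝ → Fin n → ℂ} {c' : Fin n → ℂ} {t : ℝ} (hc : HasDerivAt c c' t) :
    HasDerivAt (fun t => energy M a (c t))
      (∑ i ∈ stableIndices M, (2 / a) ^ (2 * (i : ℕ)) * (2 * inner ℝ (c t i) (c' i))) t :=
  HasDerivAt.fun_sum fun i _ => ((hasDerivAt_pi.1 hc i).norm_sq).const_mul _

/-- The energy decays exponentially along the solutions of `c' = M c`. -/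
theorem IsJordanLike.antitone_exp_mul_energy (hM : IsJordanLike M) (ha : 0 < a)
    (hre : ∀ i, a ≤ |(M i i).re|) {c : ℝ → Fin n → ℂ} (hc : ∀ t, HasDerivAt c (M *ᵥ c t) t) :
    Antitone fun t => Real.exp (a / 2 * t) * energy M a (c t) := by
  have hd : ∀ t, HasDerivAt (fun t => Real.exp (a / 2 * t) * energy M a (c t)) _ t := fun t =>
    (((hasDerivAt_id t).const_mul (a / 2)).exp).mul (hasDerivAt_energy (hc t))
  refine antitone_of_hasDerivAt_nonpos hd fun t => ?_
  have h1 := hM.sum_inner_le ha hre (c t)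
  have h2 := Real.exp_pos (a / 2 * t)
  simp only [id, mul_one, Pi.zero_apply]
  nlinarith

theorem IsJordanLike.antitone_energy (hM : IsJordanLike M) (ha : 0 < a)
    (hre : ∀ i, a ≤ |(M i i).re|) {c : ℝ → Fin n → ℂ} (hc : ∀ t, HasDerivAt c (M *ᵥ c t) t) :
    Antitone fun t => energy M a (c t) := by
  refine antitone_of_hasDerivAt_nonpos (fun t => hasDerivAt_energy (hc t)) fun t => ?_
  have h1 := hM.sum_inner_le ha hre (c t)
  have h2 : 0 ≤ energy M a (c t) := energy_nonneg ha _
  simp only [Pi.zero_apply]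
  nlinarith

/-- The stable coordinates of a solution of `c' = M c` tend to zero. -/
theorem IsJordanLike.tendsto_stable (hM : IsJordanLike M) (ha : 0 < a) (ha1 : a ≤ 1)
    (hre : ∀ i, a ≤ |(M i i).re|) {c : ℝ → Fin n → ℂ} (hc : ∀ t, HasDerivAt c (M *ᵥ c t) t)
    {i : Fin n} (hi : (M i i).re < 0) : Tendsto (fun t => c t i) atTop (𝓝 0) := by
  have hexp : Tendsto (fun t : ℝ => Real.exp (-(a / 2 * t)) * energy M a (c 0)) atTop (𝓝 0) := by
    have : Tendsto (fun t : ℝ => a / 2 * t) atTop atTop :=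
      tendsto_id.const_mul_atTop (by positivity)
    simpa using (Real.tendsto_exp_neg_atTop_nhds_zero.comp this).mul_const (energy M a (c 0))
  have hsq : Tendsto (fun t => ‖c t i‖ ^ 2) atTop (𝓝 0) := by
    refine tendsto_of_tendsto_of_tendsto_of_le_of_le' tendsto_const_nhds hexp
      (Eventually.of_forall fun t => by positivity) ?_
    filter_upwards [eventually_ge_atTop 0] with t ht
    refine (norm_sq_le_energy ha ha1 (c t) (mem_stableIndices.2 hi)).trans ?_
    have h := hM.antitone_exp_mul_energy ha hre hc ht
    simp only [mul_zero, Real.exp_zero, one_mul] at h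
    rw [Real.exp_neg, inv_mul_eq_div, le_div_iff₀ (Real.exp_pos _)]
    linarith
  have := (Real.continuous_sqrt.tendsto 0).comp hsq
  rw [tendsto_zero_iff_norm_tendsto_zero]
  simpa [Function.comp_def, Real.sqrt_sq] using this

/-- A solution of `c' = M c` that tends to zero has no unstable coordinates. -/
theorem IsJordanLike.unstable_eq_zero (hM : IsJordanLike M) (ha : 0 < a) (ha1 : a ≤ 1)
    (hre : ∀ i, a ≤ |(M i i).re|) {c : ℝ → Fin n → ℂ} (hc : ∀ t, HasDerivAt c (M *ᵥ c t) t)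
    (hlim : Tendsto c atTop (𝓝 0)) {i : Fin n} (hi : 0 < (M i i).re) : c 0 i = 0 := by
  have hc' : ∀ t, HasDerivAt (fun t => c (-t)) (-M *ᵥ c (-t)) t := fun t => by
    simpa [Function.comp_def, Matrix.neg_mulVec] using
      (hc (-t)).scomp t (hasDerivAt_neg t)
  -- Unstable coordinates of `M` are stable for `-M`, so their energy is nondecreasing in forward
  -- time; tending to 0, it must vanish at time 0.
  have hanti := hM.neg.antitone_energy (a := a) ha (by simpa using hre) hc'
  have hE : Tendsto (fun t => energy (-M) a (c t)) atTop (𝓝 0) := by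
    have := ((continuous_energy (M := -M) (a := a)).tendsto 0).comp hlim
    rwa [energy_zero] at this
  have h0 : energy (-M) a (c 0) ≤ 0 := by
    refine ge_of_tendsto hE ?_
    filter_upwards [eventually_ge_atTop 0] with t ht
    simpa using hanti (neg_nonpos.2 ht)
  have := norm_sq_le_energy ha ha1 (c 0) (M := -M) (i := i)
    (mem_stableIndices.2 (by simpa using hi))
  have h2 : ‖c 0 i‖ ^ 2 = 0 := le_antisymm (this.trans h0) (by positivity)
  simpa using h2

end Energy

/-! ### Invariance of the spectral coordinate subspaces. -/

section Projection

variable {M : Matrix (Fin n) (Fin n) ℂ}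

/-- The projection onto the coordinates `i` with `p (M i i)`. -/
noncomputable def spectralProj (M : Matrix (Fin n) (Fin n) ℂ) (p : ℂ → Prop) [DecidablePred p] :
    Matrix (Fin n) (Fin n) ℂ :=
  diagonal fun i => if p (M i i) then 1 else 0

theorem spectralProj_mulVec_eq_zero {p : ℂ → Prop} [DecidablePred p] {v : Fin n → ℂ} :
    spectralProj M p *ᵥ v = 0 ↔ ∀ i, p (M i i) → v i = 0 := by
  simp [funext_iff, spectralProj, mulVec_diagonal]

theorem IsJordanLike.commute_spectralProj (hM : IsJordanLike M) (p : ℂ → Prop) [DecidablePred p] :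
    Commute (spectralProj M p) M := by
  ext i j
  rw [spectralProj, diagonal_mul, mul_diagonal]
  by_cases hij : i = j
  · subst hij; ring
  by_cases h0 : M i j = 0
  · simp [h0]
  · rw [(hM i j hij h0).2.2]; ring

theorem IsJordanLike.exp_smul_mulVec_eq_zero_iff (hM : IsJordanLike M) (p : ℂ → Prop) (r : ℂ)
    (v : Fin n → ℂ) :
    (∀ i, p (M i i) → (NormedSpace.exp (r • M) *ᵥ v) i = 0) ↔ ∀ i, p (M i i) → v i = 0 := by
  classical
  have hcomm : Commute (spectralProj M p) (NormedSpace.exp (r • M)) :=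
    ((hM.commute_spectralProj p).smul_right r).exp_right
  rw [← spectralProj_mulVec_eq_zero, ← spectralProj_mulVec_eq_zero, mulVec_mulVec, hcomm.eq,
    ← mulVec_mulVec]
  refine ⟨fun h => ?_, fun h => by rw [h, mulVec_zero]⟩
  exact mulVec_injective_of_isUnit (Matrix.isUnit_exp _) (h.trans (mulVec_zero _).symm)

/-- The flow of `c' = M c` leaves the spectral subspaces invariant. -/
theorem IsJordanLike.solution_eq_zero (hM : IsJordanLike M) (p : ℂ → Prop)
    {c : ℝ → Fin n → ℂ} (hc : ∀ t, HasDerivAt c (M *ᵥ c t) t) (h0 : ∀ i, p (M i i) → c 0 i = 0)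
    (t : ℝ) : ∀ i, p (M i i) → c t i = 0 := by
  classical
  have hlip := (M.mulVecLin).toContinuousLinearMap.lipschitz
  have hd : ∀ t, HasDerivAt (fun t => spectralProj M p *ᵥ c t)
      (M *ᵥ (spectralProj M p *ᵥ c t)) t := fun t => by
    have h := ((((spectralProj M p).mulVecLin).toContinuousLinearMap.restrictScalars
      ℝ).hasFDerivAt (x := c t)).comp_hasDerivAt t (hc t)
    rw [mulVec_mulVec, ← (hM.commute_spectralProj p).eq, ← mulVec_mulVec]
    exact h
  have heq := ODE_solution_unique_univ (v := fun _ x => M *ᵥ x) (s := fun _ => Set.univ)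
    (f := fun t => spectralProj M p *ᵥ c t) (g := fun _ => 0) (t₀ := 0)
    (fun _ => hlip.lipschitzOnWith) (fun t => ⟨hd t, trivial⟩)
    (fun t => ⟨by simpa using hasDerivAt_const t (0 : Fin n → ℂ), trivial⟩)
    (spectralProj_mulVec_eq_zero.2 h0)
  exact spectralProj_mulVec_eq_zero.1 (congrFun heq t)

end Projection

/-! ### Uniqueness of solutions, group laws and the linear flow. -/

section Flow

variable {D : Set (E n)} {F : E n → E n} {S : ℝ → E n → E n}

/-- `F` is only locally Lipschitz, so uniqueness is local; it makes the set of agreement times open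
as well as closed in the connected line. -/
theorem solution_unique (hD : IsOpen D) (hF : ContDiffOn ℝ 2 F D) {f g : ℝ → E n}
    (hf : ∀ t, f t ∈ D ∧ HasDerivAt f (F (f t)) t) (hg : ∀ t, g t ∈ D ∧ HasDerivAt g (F (g t)) t)
    {t₀ : ℝ} (h0 : f t₀ = g t₀) : f = g := by
  have hfc : Continuous f := continuous_iff_continuousAt.2 fun t => (hf t).2.continuousAt
  have hgc : Continuous g := continuous_iff_continuousAt.2 fun t => (hg t).2.continuousAt
  have hclopen : IsClopen {t | f t = g t} := by
    refine ⟨isClosed_eq hfc hgc, isOpen_iff_mem_nhds.2 fun t (ht : f t = g t) => ?_⟩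
    obtain ⟨K, U, hU, hlip⟩ := ((hF.contDiffAt (hD.mem_nhds (hf t).1)).of_le
      (by norm_num : (1 : WithTop ℕ∞) ≤ 2)).exists_lipschitzOnWith
    exact ODE_solution_unique_of_eventually (v := fun _ => F) (s := fun _ => U)
      (Eventually.of_forall fun _ => hlip)
      ((hfc.continuousAt.eventually_mem hU).mono fun s hs => ⟨(hf s).2, hs⟩)
      ((hgc.continuousAt.eventually_mem (ht ▸ hU)).mono fun s hs => ⟨(hg s).2, hs⟩) ht
  funext t
  exact (hclopen.eq_univ ⟨t₀, h0⟩ ▸ Set.mem_univ t : t ∈ {t | f t = g t})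

theorem IsFlowOn.continuous (hS : IsFlowOn F D S) {x : E n} (hx : x ∈ D) :
    Continuous fun t => S t x :=
  continuous_iff_continuousAt.2 fun t => ((hS x hx).2 t).2.continuousAt

theorem IsFlowOn.add (hS : IsFlowOn F D S) (hD : IsOpen D) (hF : ContDiffOn ℝ 2 F D) {x : E n}
    (hx : x ∈ D) (t s : ℝ) : S (t + s) x = S t (S s x) := by
  have hy := ((hS x hx).2 s).1
  have h := solution_unique hD hF (f := fun t => S (t + s) x) (g := fun t => S t (S s x)) (t₀ := 0)
    (fun t => ⟨((hS x hx).2 _).1, ((hS x hx).2 (t + s)).2.comp_add_const t s⟩)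
    (fun t => (hS _ hy).2 t) (by simp [(hS _ hy).1])
  exact congrFun h t

theorem IsFlowOn.apply_zero (hS : IsFlowOn F D S) (hD : IsOpen D) (hF : ContDiffOn ℝ 2 F D)
    (h0 : (0 : E n) ∈ D) (hF0 : F 0 = 0) (t : ℝ) : S t 0 = 0 := by
  have h := solution_unique hD hF (f := fun t => S t 0) (g := fun _ => 0) (t₀ := 0)
    (fun t => (hS 0 h0).2 t) (fun t => ⟨h0, by rw [hF0]; exact hasDerivAt_const t 0⟩) (hS 0 h0).1
  exact congrFun h t

theorem exp_add_smul {𝔸 : Type*} [NormedRing 𝔸] [NormedAlgebra ℝ 𝔸] [CompleteSpace 𝔸] (x : 𝔸)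
    (s t : ℝ) : NormedSpace.exp ((s + t) • x) = NormedSpace.exp (s • x) * NormedSpace.exp (t • x) := by
  let _ := NormedAlgebra.restrictScalars ℚ ℝ 𝔸
  rw [add_smul, NormedSpace.exp_add_of_commute (((Commute.refl x).smul_left s).smul_right t)]

theorem linFlow_zero (F : E n → E n) : linFlow F 0 = 1 := by
  rw [linFlow, zero_smul ℝ (fderiv ℝ F 0), NormedSpace.exp_zero]

theorem linFlow_add (F : E n → E n) (s t : ℝ) (y : E n) :
    linFlow F (s + t) y = linFlow F s (linFlow F t y) := by
  have h : linFlow F (s + t) = linFlow F s * linFlow F t := exp_add_smul (fderiv ℝ F 0) s t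
  rw [h]; rfl

theorem hasDerivAt_linFlow (F : E n → E n) (y : E n) (t : ℝ) :
    HasDerivAt (fun t => linFlow F t y) (fderiv ℝ F 0 (linFlow F t y)) t :=
  (hasDerivAt_exp_smul_const' (𝕂 := ℝ) (fderiv ℝ F 0) t).clm_apply (hasDerivAt_const t y)
    |>.congr_deriv (by simp [linFlow])

theorem continuous_linFlow (F : E n → E n) (y : E n) : Continuous fun t => linFlow F t y :=
  continuous_iff_continuousAt.2 fun t => (hasDerivAt_linFlow F y t).continuousAt

end Flow

/-! ### Passage from real vectors to Jordan coordinates. -/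

section Coordinates

/-- The coordinates `V⁻¹ y` of a real vector `y`. -/
noncomputable def eigenCoord (V : Matrix (Fin n) (Fin n) ℂ) : E n →L[ℝ] (Fin n → ℂ) :=
  LinearMap.toContinuousLinearMap
    { toFun := fun y => V⁻¹ *ᵥ fun i => ((y i : ℝ) : ℂ)
      map_add' := fun x y => by
        rw [← mulVec_add]; congr 1; ext i; simp
      map_smul' := fun r y => by
        simp only [RingHom.id_apply]
        rw [← mulVec_smul]; congr 1; ext i; simp }

theorem eigenCoord_apply (V : Matrix (Fin n) (Fin n) ℂ) (y : E n) :
    eigenCoord V y = V⁻¹ *ᵥ fun i => ((y i : ℝ) : ℂ) := rfl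

/-- The real part of `V c`, which recovers a real vector from its coordinates. -/
noncomputable def ofCoord (V : Matrix (Fin n) (Fin n) ℂ) (c : Fin n → ℂ) : E n :=
  WithLp.toLp 2 fun i => ((V *ᵥ c) i).re

theorem continuous_ofCoord (V : Matrix (Fin n) (Fin n) ℂ) : Continuous (ofCoord V) := by
  unfold ofCoord; fun_prop

theorem ofCoord_zero (V : Matrix (Fin n) (Fin n) ℂ) : ofCoord V 0 = 0 := by
  ext i; simp [ofCoord]

theorem ofCoord_eigenCoord {V : Matrix (Fin n) (Fin n) ℂ} (hV : IsUnit V.det) (y : E n) :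
    ofCoord V (eigenCoord V y) = y := by
  ext i
  simp [ofCoord, eigenCoord_apply, mulVec_mulVec, mul_nonsing_inv V hV]

theorem jacobian_mulVec (F : E n → E n) (y : E n) :
    (jacobian F *ᵥ fun i => ((y i : ℝ) : ℂ)) = fun i => ((fderiv ℝ F 0 y i : ℝ) : ℂ) := by
  ext i
  have hy : y = ∑ j, y j • EuclideanSpace.single j (1 : ℝ) := by
    ext k
    simp [Finset.sum_apply, Pi.single_apply]
  conv_rhs => rw [hy]
  simp only [map_sum, map_smul, mulVec, dotProduct, jacobian, of_apply]
  simp [mul_comm]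

variable {F : E n → E n} {V J : Matrix (Fin n) (Fin n) ℂ}

theorem eigenCoord_fderiv (hV : IsUnit V.det) (hVJ : V⁻¹ * jacobian F * V = J) (y : E n) :
    eigenCoord V (fderiv ℝ F 0 y) = J *ᵥ eigenCoord V y := by
  rw [eigenCoord_apply, eigenCoord_apply, ← jacobian_mulVec, mulVec_mulVec, mulVec_mulVec, ← hVJ,
    mul_assoc _ V, mul_nonsing_inv V hV, mul_one]

/-- The factor `r` is there for `r = ±1`, so that one argument covers both time directions. -/
theorem hasDerivAt_eigenCoord_linFlow (hV : IsUnit V.det) (hVJ : V⁻¹ * jacobian F * V = J)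
    (y : E n) (r t : ℝ) :
    HasDerivAt (fun t => eigenCoord V (linFlow F (r * t) y))
      ((r • J) *ᵥ eigenCoord V (linFlow F (r * t) y)) t := by
  have h1 := (eigenCoord V).hasFDerivAt.comp_hasDerivAt (r * t) (hasDerivAt_linFlow F y (r * t))
  have h2 := h1.scomp t ((hasDerivAt_id t).const_mul r)
  rw [eigenCoord_fderiv hV hVJ] at h2
  simpa [Function.comp_def, smul_mulVec] using h2

/-- `J` is upper triangular and similar to `A`, so its diagonal entries are eigenvalues of `A`. -/
theorem IsJordan.re_diag_ne_zero (hJ : IsJordan J) (hhyp : IsHyperbolic F) (hV : IsUnit V.det)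
    (hVJ : V⁻¹ * jacobian F * V = J) (i : Fin n) : (J i i).re ≠ 0 := by
  refine hhyp _ ?_
  rw [spectrum.mem_iff, isUnit_iff_isUnit_det]
  set B := algebraMap ℂ (Matrix (Fin n) (Fin n) ℂ) (J i i) with hB
  have hconj : V⁻¹ * (B - jacobian F) * V = B - J := by
    rw [mul_sub, sub_mul, hVJ, ← Algebra.commutes, mul_assoc, nonsing_inv_mul V hV, mul_one]
  have hdet : (B - J).det = (B - jacobian F).det := by
    rw [← hconj, det_mul, det_mul, mul_comm, ← mul_assoc, ← det_mul, mul_nonsing_inv V hV, det_one,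
      one_mul]
  have htri : (B - J).BlockTriangular id := by
    intro k l hkl
    have hkl' : (l : ℕ) < k := hkl
    have hne : k ≠ l := fun h => by subst h; exact lt_irrefl _ hkl'
    have h0 : J k l = 0 := by
      by_contra h0
      have := (hJ k l hne h0).1
      omega
    simp [hB, h0, algebraMap_matrix_apply, hne]
  rw [← hdet, det_of_isUpperTriangular htri, Finset.prod_eq_zero (Finset.mem_univ i)]
  · simp
  · simp [hB, algebraMap_matrix_apply]

theorem exists_pos_le_abs_re {J : Matrix (Fin n) (Fin n) ℂ} (h : ∀ i, (J i i).re ≠ 0) :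
    ∃ a : ℝ, 0 < a ∧ a ≤ 1 ∧ ∀ i, a ≤ |(J i i).re| := by
  have h1 : ∀ᶠ a : ℝ in 𝓝[>] 0, ∀ i, a ≤ |(J i i).re| :=
    eventually_all.2 fun i => nhdsWithin_le_nhds (eventually_le_nhds (abs_pos.2 (h i)))
  have h2 : ∀ᶠ a : ℝ in 𝓝[>] 0, a ≤ 1 :=
    nhdsWithin_le_nhds (eventually_le_nhds one_pos)
  obtain ⟨a, ⟨ha, ha1⟩, ha2⟩ := ((eventually_mem_nhdsWithin.and h2).and h1).exists
  exact ⟨a, ha, ha1, ha2⟩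

end Coordinates

/-! ### From the local conjugacy to admissible sets and local manifolds. -/

section Conjugacy

variable {D : Set (E n)} {F : E n → E n} {S : ℝ → E n → E n}
  {h : OpenPartialHomeomorph (E n) (E n)}

/-- The conjugacy holds along every piece of trajectory in the domain of `h`. -/
theorem IsLinearization.conj_of_mem (hh : IsLinearization F D S h) (hS : IsFlowOn F D S)
    (hD : IsOpen D) (hF : ContDiffOn ℝ 2 F D) {x : E n} (hx : x ∈ D) {T : Set ℝ}
    (hT : T.OrdConnected) (h0 : (0 : ℝ) ∈ T) (hmem : ∀ t ∈ T, S t x ∈ h.source) {t : ℝ}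
    (ht : t ∈ T) : h (S t x) = linFlow F t (h x) := by
  -- Pulled back to time 0 by the linear flow, `h (S a x)` is locally constant in `a`, hence
  -- constant on the interval `T`.
  have hloc : ∀ a ∈ T, ∀ᶠ b in 𝓝[T] a,
      linFlow F (-a) (h (S a x)) = linFlow F (-b) (h (S b x)) := by
    intro a ha
    obtain ⟨I, hIo, -, hI0, hI⟩ := hh.conj _ (hmem a ha)
    have hev : ∀ᶠ b in 𝓝 a, b - a ∈ I :=
      (continuous_sub_right a).continuousAt.eventually_mem (hIo.mem_nhds (by simpa using hI0))
    refine nhdsWithin_le_nhds (hev.mono fun b hb => ?_)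
    have h1 := (hI _ hb).2
    rw [← hS.add hD hF hx, sub_add_cancel] at h1
    rw [h1, ← linFlow_add]
    congr 2; ring
  have heq := hT.isPreconnected.induction₂
    (fun a b => linFlow F (-a) (h (S a x)) = linFlow F (-b) (h (S b x))) hloc
    (fun _ _ _ _ _ _ h1 h2 => h1.trans h2) (fun _ _ _ _ h1 => h1.symm) ht h0
  rw [neg_zero, linFlow_zero, (hS x hx).1] at heq
  change _ = h x at heq
  rw [← heq, ← linFlow_add, add_neg_cancel, linFlow_zero]
  rfl

/-- The trajectories of the flow are the images of those of the linear flow. -/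
theorem IsLinearization.eq_symm_linFlow (hh : IsLinearization F D S h) (hS : IsFlowOn F D S)
    (hD : IsOpen D) (hF : ContDiffOn ℝ 2 F D) {x : E n} (hx : x ∈ h.source) {T : Set ℝ}
    (hT : T.OrdConnected) (h0 : (0 : ℝ) ∈ T) (hmem : ∀ t ∈ T, linFlow F t (h x) ∈ h.target) {t : ℝ}
    (ht : t ∈ T) : S t x = h.symm (linFlow F t (h x)) := by
  have hxD := hh.source_subset hx
  have hSc := hS.continuous hxD
  -- Whether the two curves agree is locally constant: agreement persists by the conjugacy,
  -- disagreement by continuity. It need not be known beforehand that `S t x` stays in `h.source`.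
  have hloc : ∀ a ∈ T, ∀ᶠ b in 𝓝[T] a,
      (S a x = h.symm (linFlow F a (h x)) ↔ S b x = h.symm (linFlow F b (h x))) := by
    intro a ha
    by_cases hab : S a x = h.symm (linFlow F a (h x))
    · have hsrc : S a x ∈ h.source := hab ▸ h.map_target (hmem a ha)
      obtain ⟨I, hIo, -, hI0, hI⟩ := hh.conj _ hsrc
      have hev : ∀ᶠ b in 𝓝 a, b - a ∈ I :=
        (continuous_sub_right a).continuousAt.eventually_mem (hIo.mem_nhds (by simpa using hI0))
      refine nhdsWithin_le_nhds (hev.mono fun b hb => ?_)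
      obtain ⟨h1, h2⟩ := hI _ hb
      rw [← hS.add hD hF hxD, sub_add_cancel] at h1 h2
      rw [hab, h.right_inv (hmem a ha), ← linFlow_add, sub_add_cancel] at h2
      exact iff_of_true hab (by rw [← h2, h.left_inv h1])
    · have hu : ContinuousAt (fun b => h.symm (linFlow F b (h x))) a :=
        (h.continuousAt_symm (hmem a ha)).comp (f := fun b => linFlow F b (h x))
          (continuous_linFlow F (h x)).continuousAt
      have hev : ∀ᶠ b in 𝓝 a, S b x ≠ h.symm (linFlow F b (h x)) :=
        hSc.continuousAt.ne_iff_eventually_ne hu |>.1 hab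
      exact nhdsWithin_le_nhds (hev.mono fun b hb => iff_of_false hab hb)
  refine (hT.isPreconnected.induction₂
    (fun a b => S a x = h.symm (linFlow F a (h x)) ↔ S b x = h.symm (linFlow F b (h x))) hloc
    (fun _ _ _ _ _ _ h1 h2 => h1.trans h2) (fun _ _ _ _ h1 => h1.symm) h0 ht).1 ?_
  rw [(hS x hxD).1, linFlow_zero]
  exact (h.left_inv hx).symm

variable {V J : Matrix (Fin n) (Fin n) ℂ}

/-- The origin is the only equilibrium of the linear flow, so `h` fixes it. -/
theorem IsLinearization.apply_zero (hh : IsLinearization F D S h) (hS : IsFlowOn F D S)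
    (hD : IsOpen D) (hF : ContDiffOn ℝ 2 F D) (h0 : (0 : E n) ∈ D) (hF0 : F 0 = 0)
    (hhyp : IsHyperbolic F) : h 0 = 0 := by
  have hS0 := hS.apply_zero hD hF h0 hF0
  have hconst : ∀ t, linFlow F t (h 0) = h 0 := fun t => by
    have := hh.conj_of_mem hS hD hF h0 (T := Set.univ) Set.ordConnected_univ trivial
      (fun t _ => (hS0 t).symm ▸ hh.zero_mem) (Set.mem_univ t)
    rw [← this, hS0]
  have hder : fderiv ℝ F 0 (h 0) = 0 := by
    have h1 := hasDerivAt_linFlow F (h 0) 0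
    simp only [hconst] at h1
    exact h1.unique (hasDerivAt_const 0 (h 0))
  have hunit : IsUnit (jacobian F) := by
    by_contra hu
    exact hhyp 0 (spectrum.zero_mem ℂ hu) rfl
  have h2 := jacobian_mulVec F (h 0)
  rw [hder] at h2
  have h3 := mulVec_injective_of_isUnit hunit (a₁ := fun i => ((h 0 i : ℝ) : ℂ)) (a₂ := 0)
    (h2.trans (by ext i; simp))
  ext i
  simpa using congrFun h3 i

/-- Sublevel sets of the two energies. -/
theorem exists_energy_sublevel (hV : IsUnit V.det) (hre : ∀ i, (J i i).re ≠ 0) {a : ℝ} (ha : 0 < a)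
    (ha1 : a ≤ 1) {U : Set (E n)} (hU : U ∈ 𝓝 0) :
    ∃ ε > 0, IsCompact {y | energy J a (eigenCoord V y) ≤ ε ∧ energy (-J) a (eigenCoord V y) ≤ ε} ∧
      {y | energy J a (eigenCoord V y) ≤ ε ∧ energy (-J) a (eigenCoord V y) ≤ ε} ⊆ U := by
  have hU' : ofCoord V ⁻¹' U ∈ 𝓝 0 :=
    (continuous_ofCoord V).continuousAt.preimage_mem_nhds (by rwa [ofCoord_zero])
  obtain ⟨r, hr, hball⟩ := Metric.nhds_basis_closedBall.mem_iff.1 hU'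
  have hsub : {y | energy J a (eigenCoord V y) ≤ r ^ 2 ∧ energy (-J) a (eigenCoord V y) ≤ r ^ 2} ⊆
      ofCoord V '' Metric.closedBall 0 r := by
    rintro y ⟨h1, h2⟩
    refine ⟨eigenCoord V y, ?_, ofCoord_eigenCoord hV y⟩
    rw [mem_closedBall_zero_iff, pi_norm_le_iff_of_nonneg hr.le]
    intro i
    refine le_of_sq_le_sq ?_ hr.le
    -- By hyperbolicity every coordinate is controlled by one of the two energies.
    rcases lt_or_gt_of_ne (hre i) with hi | hi
    · exact (norm_sq_le_energy ha ha1 _ (mem_stableIndices.2 hi)).trans h1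
    · exact (norm_sq_le_energy (M := -J) ha ha1 _
        (mem_stableIndices.2 (by simpa using hi))).trans h2
  refine ⟨r ^ 2, by positivity, ?_, hsub.trans (Set.image_subset_iff.2 hball)⟩
  refine ((isCompact_closedBall 0 r).image (continuous_ofCoord V)).of_isClosed_subset ?_ hsub
  exact (isClosed_le (continuous_energy.comp (eigenCoord V).continuous) continuous_const).inter
    (isClosed_le (continuous_energy.comp (eigenCoord V).continuous) continuous_const)

theorem energy_eigenCoord_smul {M : Matrix (Fin n) (Fin n) ℂ} {a : ℝ} (r : ℝ) (y : E n) :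
    energy M a (eigenCoord V (r • y)) = r ^ 2 * energy M a (eigenCoord V y) := by
  rw [map_smul, ← energy_smul]
  congr 1

/-- Along the linear flow the energy of `J` is nonincreasing and that of `-J` nondecreasing, so a
trajectory meets the box `C` in an interval of times. -/
theorem IsLinearization.exists_isAdmissible (hh : IsLinearization F D S h) (hz : h 0 = 0)
    (hhyp : IsHyperbolic F) (hV : IsUnit V.det) (hJ : IsJordan J)
    (hVJ : V⁻¹ * jacobian F * V = J) {O : Set (E n)} (hO : O ∈ 𝓝 (0 : E n)) :
    ∃ N ⊆ O, IsAdmissible F h N := by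
  have hre := hJ.re_diag_ne_zero hhyp hV hVJ
  obtain ⟨a, ha, ha1, hare⟩ := exists_pos_le_abs_re hre
  have h0t : (0 : E n) ∈ h.target := hz ▸ h.map_source hh.zero_mem
  have hsz : h.symm 0 = 0 := by
    conv_lhs => rw [← hz]
    exact h.left_inv hh.zero_mem
  have hU : h.target ∩ h.symm ⁻¹' O ∈ 𝓝 (0 : E n) :=
    inter_mem (h.open_target.mem_nhds h0t)
      ((h.continuousAt_symm h0t).preimage_mem_nhds (by rwa [hsz]))
  obtain ⟨ε, hε, hcomp, hsub⟩ := exists_energy_sublevel hV hre ha ha1 hU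
  set C := {y | energy J a (eigenCoord V y) ≤ ε ∧ energy (-J) a (eigenCoord V y) ≤ ε} with hC
  set B := {y | energy J a (eigenCoord V y) < ε ∧ energy (-J) a (eigenCoord V y) < ε} with hB
  have hBC : B ⊆ C := fun y hy => ⟨hy.1.le, hy.2.le⟩
  have hCt : C ⊆ h.target := fun y hy => (hsub hy).1
  have hBo : IsOpen B :=
    (isOpen_lt (continuous_energy.comp (eigenCoord V).continuous) continuous_const).inter
      (isOpen_lt (continuous_energy.comp (eigenCoord V).continuous) continuous_const)
  have h0B : (0 : E n) ∈ B := by simpa [hB, energy_zero] using hε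
  -- Homogeneity of degree two: radial shrinking moves the closed box into the open one. This gives
  -- both connectedness of `B` and density of `B` in `C`.
  have hscale : ∀ r : ℝ, 0 ≤ r → r < 1 → ∀ y ∈ C, r • y ∈ B := by
    intro r hr0 hr1 y hy
    have hr2 : r ^ 2 < 1 := by nlinarith
    have key : ∀ e : ℝ, 0 ≤ e → e ≤ ε → r ^ 2 * e < ε := fun e he0 he => by nlinarith [sq_nonneg r]
    refine ⟨?_, ?_⟩
    · rw [energy_eigenCoord_smul]
      exact key _ (energy_nonneg ha _) hy.1
    · rw [energy_eigenCoord_smul]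
      exact key _ (energy_nonneg ha _) hy.2
  have hBconn : IsConnected B := by
    refine (StarConvex.isPathConnected (a := 0) ?_ h0B).isConnected
    refine starConvex_zero_iff.2 fun y hy r hr0 hr1 => ?_
    rcases hr1.lt_or_eq with hr1 | rfl
    · exact hscale r hr0 hr1 y (hBC hy)
    · rwa [one_smul]
  have hclos : closure (h.symm '' B) = h.symm '' C := by
    apply subset_antisymm
    · exact closure_minimal (Set.image_mono hBC)
        (hcomp.image_of_continuousOn (h.symm.continuousOn.mono hCt)).isClosed
    · rintro _ ⟨y, hy, rfl⟩
      have hlim : Tendsto (fun r : ℝ => h.symm (r • y)) (𝓝[<] 1) (𝓝 (h.symm y)) := by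
        refine (h.continuousAt_symm (hCt hy)).tendsto.comp (tendsto_nhdsWithin_of_tendsto_nhds ?_)
        have : Continuous fun r : ℝ => r • y := by fun_prop
        simpa using this.tendsto 1
      refine mem_closure_of_tendsto hlim ?_
      filter_upwards [self_mem_nhdsWithin, nhdsWithin_le_nhds (eventually_ge_nhds one_pos)]
        with r hr1 hr0
      exact Set.mem_image_of_mem _ (hscale r hr0 hr1 y hy)
  have himg : h '' closure (h.symm '' B) = C := by
    rw [hclos, Set.image_image]
    exact (Set.image_congr fun y hy => h.right_inv (hCt hy)).trans (Set.image_id _)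
  refine ⟨h.symm '' B, ?_, ?_, ?_, ?_, ?_, ?_⟩
  · rintro _ ⟨y, hy, rfl⟩
    exact (hsub (hBC hy)).2
  · exact h.symm.isOpen_image_of_subset_source hBo (hBC.trans hCt)
  · exact hBconn.image _ (h.symm.continuousOn.mono (hBC.trans hCt))
  · exact ⟨0, h0B, hsz⟩
  · rw [hclos]
    rintro _ ⟨y, hy, rfl⟩
    exact h.map_target (hCt hy)
  · rw [himg]
    intro y _
    have h1 := hJ.isJordanLike.antitone_energy ha hare
      (fun t => by simpa using hasDerivAt_eigenCoord_linFlow hV hVJ y 1 t)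
    have h2 := hJ.isJordanLike.neg.antitone_energy (a := a) ha (by simpa using hare)
      (fun t => by simpa using hasDerivAt_eigenCoord_linFlow hV hVJ y (-1) t)
    refine ⟨fun t₁ ht₁ t₂ ht₂ t ht => ⟨(h1 ht.1).trans ht₁.1, ?_⟩⟩
    have h3 := h2 (neg_le_neg ht.2)
    simp only [neg_neg] at h3
    exact h3.trans ht₂.2

/-- The points of the closure of `N` whose trajectory (backwards in time for `r = -1`) stays there
and tends to the origin are the zeros of the eigenfunctions that grow in that time direction. -/
theorem IsAdmissible.localEigen_eq_zero_iff {N : Set (E n)} (hN : IsAdmissible F h N)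
    (hh : IsLinearization F D S h) (hz : h 0 = 0) (hS : IsFlowOn F D S)
    (hD : IsOpen D) (hF : ContDiffOn ℝ 2 F D) (hhyp : IsHyperbolic F) (hV : IsUnit V.det)
    (hJ : IsJordan J) (hVJ : V⁻¹ * jacobian F * V = J) {x : E n} (hx : x ∈ closure N) {r : ℝ}
    (hr : r = 1 ∨ r = -1) :
    (∀ i, 0 < r * (J i i).re → localEigen h V x i = 0) ↔
      (∀ t, 0 ≤ t → S (r * t) x ∈ closure N) ∧ Tendsto (fun t => S (r * t) x) atTop (𝓝 0) := by
  have hre := hJ.re_diag_ne_zero hhyp hV hVJ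
  obtain ⟨a, ha, ha1, hare⟩ := exists_pos_le_abs_re hre
  have hM : IsJordanLike (r • J) := by
    rcases hr with rfl | rfl
    · simpa using hJ.isJordanLike
    · simpa using hJ.isJordanLike.neg
  have hMre : ∀ i, ((r • J) i i).re = r * (J i i).re := fun i => by simp
  have hMa : ∀ i, a ≤ |((r • J) i i).re| := fun i => by
    rw [hMre]
    rcases hr with rfl | rfl <;> simpa using hare i
  have hrr : r * r = 1 := by rcases hr with rfl | rfl <;> norm_num
  have hxs : x ∈ h.source := hN.closure_subset hx
  have hc := hasDerivAt_eigenCoord_linFlow hV hVJ (h x) r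
  have hc0 : eigenCoord V (linFlow F (r * 0) (h x)) = localEigen h V x := by
    rw [mul_zero, linFlow_zero]; rfl
  have hT : {t : ℝ | 0 ≤ r * t}.OrdConnected := by
    rcases hr with rfl | rfl
    · simpa [Set.Ici] using (Set.ordConnected_Ici : (Set.Ici (0 : ℝ)).OrdConnected)
    · simpa [Set.Iic] using (Set.ordConnected_Iic : (Set.Iic (0 : ℝ)).OrdConnected)
  have hT0 : (0 : ℝ) ∈ {t : ℝ | 0 ≤ r * t} := by simp
  have hTr : ∀ t, 0 ≤ t → r * t ∈ {t : ℝ | 0 ≤ r * t} := fun t ht => by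
    simpa [← mul_assoc, hrr] using ht
  constructor
  · intro hk
    have hunst := hM.solution_eq_zero (fun μ => 0 < μ.re) hc (fun i hi => by
      rw [hc0]; exact hk i (hMre i ▸ hi))
    have hclim : Tendsto (fun t => eigenCoord V (linFlow F (r * t) (h x))) atTop (𝓝 0) := by
      refine tendsto_pi_nhds.2 fun i => ?_
      rcases lt_or_gt_of_ne (abs_pos.1 (ha.trans_le (hMa i))) with hi | hi
      · exact hM.tendsto_stable ha ha1 hMa hc hi
      · exact tendsto_const_nhds.congr fun t => (hunst t i hi).symm
    have hlin : Tendsto (fun t => linFlow F (r * t) (h x)) atTop (𝓝 0) := by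
      have := ((continuous_ofCoord V).tendsto 0).comp hclim
      simpa [Function.comp_def, ofCoord_eigenCoord hV, ofCoord_zero] using this
    have hnhds : h '' closure N ∈ 𝓝 (0 : E n) := by
      have := h.image_mem_nhds hh.zero_mem (hN.isOpen.mem_nhds hN.zero_mem)
      rw [hz] at this
      exact mem_of_superset this (Set.image_mono subset_closure)
    have hmem : ∀ t ∈ {t : ℝ | 0 ≤ r * t}, linFlow F t (h x) ∈ h '' closure N := by
      intro t ht
      -- A time `r * s` at least as far out as `t`, with the linear trajectory already back in the
      -- image of `closure N`; order-connectedness then covers `t`.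
      obtain ⟨s, hs, hts⟩ := ((hlin.eventually_mem hnhds).and (eventually_ge_atTop (r * t))).exists
      have hoc := hN.ordConnected (h x) (Set.mem_image_of_mem h hx)
      have h0 : (0 : ℝ) ∈ {t : ℝ | linFlow F t (h x) ∈ h '' closure N} := by
        rw [Set.mem_ofPred_eq, linFlow_zero]
        exact Set.mem_image_of_mem h hx
      refine hoc.uIcc_subset h0 hs ?_
      rw [Set.mem_uIcc]
      rcases hr with rfl | rfl
      · left; simp at ht hts ⊢; exact ⟨ht, hts⟩
      · right; simp at ht hts ⊢; exact ⟨by linarith, ht⟩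
    have heq : ∀ t, 0 ≤ t → S (r * t) x = h.symm (linFlow F (r * t) (h x)) := fun t ht =>
      hh.eq_symm_linFlow hS hD hF hxs hT hT0 (fun t ht => by
        obtain ⟨y, hy, hye⟩ := hmem t ht
        exact hye ▸ h.map_source (hN.closure_subset hy)) (hTr t ht)
    refine ⟨fun t ht => ?_, ?_⟩
    · obtain ⟨y, hy, hye⟩ := hmem _ (hTr t ht)
      rw [heq t ht, ← hye, h.left_inv (hN.closure_subset hy)]
      exact hy
    · have hsz : Tendsto h.symm (𝓝 0) (𝓝 0) := by
        have := h.tendsto_symm hh.zero_mem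
        rwa [hz] at this
      refine (hsz.comp hlin).congr' ?_
      filter_upwards [eventually_ge_atTop 0] with t ht
      exact (heq t ht).symm
  · rintro ⟨hmem, hlim⟩ i hi
    have hconj : ∀ t, 0 ≤ t → h (S (r * t) x) = linFlow F (r * t) (h x) := fun t ht =>
      hh.conj_of_mem hS hD hF (hh.source_subset hxs) hT hT0 (fun t ht => by
        have := hmem _ ht
        rw [← mul_assoc, hrr, one_mul] at this
        exact hN.closure_subset this) (hTr t ht)
    have hlin : Tendsto (fun t => linFlow F (r * t) (h x)) atTop (𝓝 0) := by
      have hcont := (h.continuousAt hh.zero_mem).tendsto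
      rw [hz] at hcont
      refine (hcont.comp hlim).congr' ?_
      filter_upwards [eventually_ge_atTop 0] with t ht
      exact hconj t ht
    have hclim : Tendsto (fun t => eigenCoord V (linFlow F (r * t) (h x))) atTop (𝓝 0) := by
      simpa [Function.comp_def] using ((eigenCoord V).continuous.tendsto 0).comp hlin
    have := hM.unstable_eq_zero ha ha1 hMa hc hclim (hMre i ▸ hi)
    rwa [hc0] at this

end Conjugacy

/-! ### Entry times and reduction to the entry point. -/

section EntryTime

variable {D N : Set (E n)} {F : E n → E n} {S : ℝ → E n → E n}

/-- The entry time is attained. -/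
theorem apply_entryTime_mem (hS : IsFlowOn F D S) {z : E n} (hz : z ∈ domainP S D N) :
    S (entryTime S N z) z ∈ closure N := by
  obtain ⟨hzD, t, ht⟩ := hz
  have hcl : IsClosed {t | S t z ∈ closure N} := isClosed_closure.preimage (hS.continuous hzD)
  unfold entryTime
  split_ifs with hpos
  · exact ((isClosed_Ici.inter hcl).csInf_mem hpos ⟨0, fun _ h => h.1⟩).2
  · have hneg : t ≤ 0 := le_of_not_ge fun h => hpos ⟨t, h, ht⟩
    exact ((isClosed_Iic.inter hcl).csSup_mem ⟨t, hneg, ht⟩ ⟨0, fun _ h => h.1⟩).2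

theorem domainP_invariant (hS : IsFlowOn F D S) (hD : IsOpen D) (hF : ContDiffOn ℝ 2 F D)
    {z : E n} (hz : z ∈ domainP S D N) (τ : ℝ) : S τ z ∈ domainP S D N := by
  obtain ⟨hzD, t, ht⟩ := hz
  exact ⟨((hS z hzD).2 τ).1, t - τ, by rwa [← hS.add hD hF hzD, sub_add_cancel]⟩

/-- Zeros of the spectral components of `s` at `z` and of `k` at the entry point of `z`. -/
theorem eigenfamily_eq_zero_iff (hS : IsFlowOn F D S) (hD : IsOpen D) (hF : ContDiffOn ℝ 2 F D)
    {J : Matrix (Fin n) (Fin n) ℂ} (hJ : IsJordan J) {k s : E n → Fin n → ℂ}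
    (hs : IsFlowExtension S D N J k s ∨
      (IsOpenEigenfamily S (domainP S D N) J s ∧ Set.EqOn s k (closure N)))
    (p : ℂ → Prop) {z : E n} (hz : z ∈ domainP S D N) :
    (∀ i, p (J i i) → s z i = 0) ↔ ∀ i, p (J i i) → k (S (entryTime S N z) z) i = 0 := by
  rcases hs with hs | ⟨hs, hk⟩
  · rw [hs z hz]
    exact hJ.isJordanLike.exp_smul_mulVec_eq_zero_iff p _ _
  -- `P` is invariant under the whole flow, so the eigenfunction equation may be used with all of
  -- `ℝ` as time interval.
  · rw [← hk (apply_entryTime_mem hS hz), hs z hz Set.univ isOpen_univ Set.ordConnected_univ trivial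
      (fun τ _ => domainP_invariant hS hD hF hz τ) _ trivial]
    exact (hJ.isJordanLike.exp_smul_mulVec_eq_zero_iff p _ _).symm

/-- Convergence to 0 is unaffected by a time shift, so the entry point alone decides. -/
theorem mem_principalStable_iff (hS : IsFlowOn F D S) (hD : IsOpen D) (hF : ContDiffOn ℝ 2 F D)
    {z : E n} (hz : z ∈ domainP S D N) :
    z ∈ principalStable S D N ↔ S (entryTime S N z) z ∈ localStable S (closure N) := by
  refine ⟨fun h => h.2.2, fun h => ⟨hz, ⟨hz.1, ?_⟩, h⟩⟩
  refine (h.2.comp (tendsto_atTop_add_const_right _ (-entryTime S N z) tendsto_id)).congr fun t => ?_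
  simp only [Function.comp_apply, id]
  rw [← hS.add hD hF hz.1, neg_add_cancel_right]

theorem mem_principalUnstable_iff (hS : IsFlowOn F D S) (hD : IsOpen D) (hF : ContDiffOn ℝ 2 F D)
    {z : E n} (hz : z ∈ domainP S D N) :
    z ∈ principalUnstable S D N ↔ S (entryTime S N z) z ∈ localUnstable S (closure N) := by
  refine ⟨fun h => h.2.2, fun h => ⟨hz, ⟨hz.1, ?_⟩, h⟩⟩
  refine (h.2.comp (tendsto_atBot_add_const_right _ (-entryTime S N z) tendsto_id)).congr fun t => ?_
  simp only [Function.comp_apply, id]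
  rw [← hS.add hD hF hz.1, neg_add_cancel_right]

theorem mem_localUnstable_iff {K : Set (E n)} {x : E n} :
    x ∈ localUnstable S K ↔
      (∀ t, 0 ≤ t → S (-t) x ∈ K) ∧ Tendsto (fun t => S (-t) x) atTop (𝓝 0) := by
  refine and_congr ⟨fun h t ht => h _ (neg_nonpos.2 ht), fun h t ht => ?_⟩
    ⟨fun h => h.comp tendsto_neg_atTop_atBot, fun h => ?_⟩
  · simpa using h (-t) (neg_nonneg.2 ht)
  · simpa [Function.comp_def] using h.comp tendsto_neg_atBot_atTop

end EntryTime

end Koopman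

/-! ### The main theorem, with `r = 1` for the stable and `r = -1` for the unstable part. -/

theorem mainTheorem8 {n : ℕ} (D : Set (Koopman.E n)) (hD : IsOpen D) (h0 : (0 : Koopman.E n) ∈ D)
    (F : Koopman.E n → Koopman.E n) (hF : ContDiffOn ℝ 2 F D) (hF0 : F 0 = 0)
    (hhyp : Koopman.IsHyperbolic F)
    (S : ℝ → Koopman.E n → Koopman.E n) (hS : Koopman.IsFlowOn F D S)
    (h : OpenPartialHomeomorph (Koopman.E n) (Koopman.E n))
    (hh : Koopman.IsLinearization F D S h)
    (V J : Matrix (Fin n) (Fin n) ℂ) (hV : IsUnit V.det) (hJ : Koopman.IsJordan J)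
    (hVJ : V⁻¹ * Koopman.jacobian F * V = J) :
    (∀ O ∈ nhds (0 : Koopman.E n), ∃ N ⊆ O, Koopman.IsAdmissible F h N) ∧
    ∀ N : Set (Koopman.E n), Koopman.IsAdmissible F h N →
      ∀ s : Koopman.E n → Fin n → ℂ,
        (Koopman.IsFlowExtension S D N J (Koopman.localEigen h V) s ∨
          (Koopman.IsOpenEigenfamily S (Koopman.domainP S D N) J s ∧
            Set.EqOn s (Koopman.localEigen h V) (closure N))) →
        {x | x ∈ Koopman.domainP S D N ∧ ∀ i, 0 < (J i i).re → s x i = 0}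
            = Koopman.principalStable S D N ∧
        {x | x ∈ Koopman.domainP S D N ∧ ∀ i, (J i i).re < 0 → s x i = 0}
            = Koopman.principalUnstable S D N := by
  have hz := hh.apply_zero hS hD hF h0 hF0 hhyp
  refine ⟨fun O hO => hh.exists_isAdmissible hz hhyp hV hJ hVJ hO, fun N hN s hs => ⟨?_, ?_⟩⟩
  · have key : ∀ z ∈ Koopman.domainP S D N,
        (∀ i, 0 < (J i i).re → s z i = 0) ↔ z ∈ Koopman.principalStable S D N := fun z hzP => by
      rw [Koopman.mem_principalStable_iff hS hD hF hzP,
        Koopman.eigenfamily_eq_zero_iff hS hD hF hJ hs (fun μ => 0 < μ.re) hzP]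
      simpa [Koopman.localStable] using hN.localEigen_eq_zero_iff hh hz hS hD hF hhyp hV hJ hVJ
        (Koopman.apply_entryTime_mem hS hzP) (Or.inl rfl)
    exact Set.ext fun z => ⟨fun hx => (key z hx.1).1 hx.2, fun hx => ⟨hx.1, (key z hx.1).2 hx⟩⟩
  · have key : ∀ z ∈ Koopman.domainP S D N,
        (∀ i, (J i i).re < 0 → s z i = 0) ↔ z ∈ Koopman.principalUnstable S D N := fun z hzP => by
      rw [Koopman.mem_principalUnstable_iff hS hD hF hzP,
        Koopman.eigenfamily_eq_zero_iff hS hD hF hJ hs (fun μ => μ.re < 0) hzP,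
        Koopman.mem_localUnstable_iff]
      simpa using hN.localEigen_eq_zero_iff hh hz hS hD hF hhyp hV hJ hVJ
        (Koopman.apply_entryTime_mem hS hzP) (Or.inr rfl)
    exact Set.ext fun z => ⟨fun hx => (key z hx.1).1 hx.2, fun hx => ⟨hx.1, (key z hx.1).2 hx⟩⟩
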